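/- Let $(E_i,\pi_i,M_i,\rho_i)_{i\in\mathbb N}$ be a strong projective system of Banach Lie algebroids. That is: each $E_i\to M_i$ is a smooth Banach vector bundle over a Banach manifold, carrying a Lie algebroid structure with anchor $\rho_i:E_i\to TM_i$; for $j\ge i$ there are smooth maps $\delta_i^j:M_j\to M_i$ and Lie algebroid morphisms $f_i^j:E_j\to E_i$ over $\delta_i^j$, forming projective systems, with $\rho_i\circ f_i^j=T\delta_i^j\circ\rho_j$; the model spaces $\mathbb M_i$ of $M_i$ and the typical fibres $\mathbb E_i$ of $E_i$ form projective systems of Banach spaces; and around every point $(x_i)$ of $M=\varprojlim M_i$ there are projective systems of charts $\varphi_i:U_i\to\mathbb M_i$ of the $M_i$ and of trivializations $\tau_i:\pi_i^{-1}(V_i)\to V_i\times\mathbb E_i$, compatible with the transition maps, with $\varprojlim U_i$ and $\varprojlim V_i$ open in $M$. Put $E=\varprojlim E_i$, $\pi=\varprojlim\pi_i$, $\rho=\varprojlim\rho_i$, $TE=\varprojlim TE_i$, $TM=\varprojlim TM_i$, with $\tau_E:TE\to E$ the projection; smoothness and velocities of curves in $M$, $E$, $TE$ are taken in the limit charts,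 with values in Fréchet spaces, and a map is smooth if it maps smooth curves to smooth curves. Intervals are nondegenerate. A curve $\gamma:J\to E_i$ (or $c:J\to E$) on an interval $J$ is admissible if $(\pi_i\circ\gamma)'=\rho_i(\gamma)$ (resp. $(\pi\circ c)'=\rho(c)$) on $J$. A smooth vector field $S$ on $E_i$ (or $E$), that is, a smooth map into the tangent bundle with $\tau\circ S=\mathrm{Id}$, is a semispray if $T\pi_i\circ S=\rho_i$ (resp. $T\pi\circ S=\rho$). An integral curve of $S$ on $J$ is a smooth curve $c$ with $c'=S(c)$ on $J$. (1) If $\gamma_i:J\to E_i$ are admissible curves on an interval $J$ with $f_i^j\circ\gamma_j=\gamma_i$ for $j\ge i$, then $\gamma=\varprojlim\gamma_i:J\to E$ is admissible; it is smooth if all $\gamma_i$ are. (2) Let $S_i$ be smooth vector fields on $E_i$ with $Tf_i^j\circ S_j=S_i\circ f_i^j$ for $j\ge i$. Then $S=\varprojlim S_i:(u_0,u_1,\dots)\mapsto(S_0(u_0),S_1(u_1),\dots)$ is a smooth vector field on $E$; in particular $\tau_E\circ S=\mathrm{Id}_E$. If all $S_i$ are semisprays, then $T\pi\circ S=\rho$,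 so $S$ is a semispray. (3) Let $S=\varprojlim S_i$ be as in (2), and let $\mathcal J$ be any family of intervals (for instance all intervals, or $[0,1]$ only). If $S$ is a semispray, then all integral curves of $S$ on intervals $J\in\mathcal J$ are admissible. Conversely, if all these integral curves are admissible, then $T\pi(S(u))=\rho(u)$ at every point $u\in E$ that lies on one of them. Consequently, if all $S_i$ are semisprays, or if every point of $E$ lies on an integral curve of $S$ on some $J\in\mathcal J$, then $S$ is a semispray if and only if all integral curves of $S$ on intervals $J\in\mathcal J$ are admissible curves. -/

import Mathlib

open Set Filter Topology Bundle
open scoped Manifold ContDiff Bundle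

noncomputable section

/-! ### Banach Lie algebroids -/

/-- The derivative `X(g) = dg(X)` of a function `g` along a tangent vector `X`. -/
def dirDeriv {B : Type*} [NormedAddCommGroup B] [NormedSpace ℝ B]
    {M : Type*} [TopologicalSpace M] [ChartedSpace B M] (g : M → ℝ) {x : M}
    (X : TangentSpace 𝓘(ℝ, B) x) : ℝ :=
  mfderiv 𝓘(ℝ, B) 𝓘(ℝ) g x X

/-- A Banach Lie algebroid `(E, π, M, ρ)` over a Banach manifold `M` (modelled on `B`), where `E` is
a smooth Banach vector bundle with typical fibre `F`: an anchor `ρ : E → TM`, which is a smooth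
vector bundle morphism, and a real Lie algebra structure on the space of smooth sections of `E`, such
that the anchor induces a Lie algebra morphism into the vector fields of `M` and the Leibniz rule
holds. -/
structure BanachLieAlgebroid (B F : Type*) [NormedAddCommGroup B] [NormedSpace ℝ B]
    [NormedAddCommGroup F] [NormedSpace ℝ F]
    {M : Type*} [TopologicalSpace M] [ChartedSpace B M] [IsManifold 𝓘(ℝ, B) ∞ M]
    (E : M → Type*) [∀ x, AddCommGroup (E x)] [∀ x, Module ℝ (E x)] [∀ x, TopologicalSpace (E x)]
    [TopologicalSpace (TotalSpace F E)] [FiberBundle F E] [VectorBundle ℝ F E]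
    [ContMDiffVectorBundle ∞ F E 𝓘(ℝ, B)] where
  /-- The anchor, fibre by fibre. -/
  anchor : ∀ x : M, E x →L[ℝ] TangentSpace 𝓘(ℝ, B) x
  contMDiff_anchor : ContMDiff (𝓘(ℝ, B).prod 𝓘(ℝ, F)) 𝓘(ℝ, B).tangent ∞
    (fun u : TotalSpace F E ↦ (⟨u.proj, anchor u.proj u.2⟩ : TangentBundle 𝓘(ℝ, B) M))
  /-- The bracket of smooth sections. -/
  bracket : Cₛ^∞⟮𝓘(ℝ, B); F, E⟯ →ₗ[ℝ] Cₛ^∞⟮𝓘(ℝ, B); F, E⟯ →ₗ[ℝ] Cₛ^∞⟮𝓘(ℝ, B); F, E⟯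
  bracket_self : ∀ s, bracket s s = 0
  jacobi : ∀ s₁ s₂ s₃, bracket s₁ (bracket s₂ s₃) + bracket s₂ (bracket s₃ s₁) +
    bracket s₃ (bracket s₁ s₂) = 0
  anchor_bracket : ∀ s₁ s₂ x, anchor x (bracket s₁ s₂ x) =
    VectorField.mlieBracket 𝓘(ℝ, B) (fun y ↦ anchor y (s₁ y)) (fun y ↦ anchor y (s₂ y)) x
  leibniz : ∀ (s₁ s₂ : Cₛ^∞⟮𝓘(ℝ, B); F, E⟯) (g : M → ℝ) (hg : ContMDiff 𝓘(ℝ, B) 𝓘(ℝ) ∞ g) (x : M),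
    bracket s₁ ⟨g • ⇑s₂, hg.smul_section s₂.contMDiff⟩ x =
      g x • bracket s₁ s₂ x + dirDeriv g (anchor x (s₁ x)) • s₂ x

namespace BanachLieAlgebroid

section Single

variable {B F : Type*} [NormedAddCommGroup B] [NormedSpace ℝ B]
  [NormedAddCommGroup F] [NormedSpace ℝ F]
  {M : Type*} [TopologicalSpace M] [ChartedSpace B M] [IsManifold 𝓘(ℝ, B) ∞ M]
  {E : M → Type*} [∀ x, AddCommGroup (E x)] [∀ x, Module ℝ (E x)] [∀ x, TopologicalSpace (E x)]
  [TopologicalSpace (TotalSpace F E)] [FiberBundle F E] [VectorBundle ℝ F E]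
  [ContMDiffVectorBundle ∞ F E 𝓘(ℝ, B)]

/-- The anchor as a map `ρ : E → TM`. -/
def rho (A : BanachLieAlgebroid B F E) (u : TotalSpace F E) : TangentBundle 𝓘(ℝ, B) M :=
  ⟨u.proj, A.anchor u.proj u.2⟩

variable (B F) in
/-- A field of continuous alternating `q`-forms on the fibres of `E` is smooth if it is so when read
in the trivializations of `E`; smooth fields are the sections of `Λ^q E*`. -/
def IsSmoothForm {q : ℕ} (α : ∀ x : M, E x [⋀^Fin q]→L[ℝ] ℝ) : Prop :=
  ∀ x₀ : M, ContMDiffOn 𝓘(ℝ, B) 𝓘(ℝ, F [⋀^Fin q]→L[ℝ] ℝ) ∞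
    (fun x ↦ (α x).compContinuousLinearMap ((trivializationAt F E x₀).symmL ℝ x))
    (trivializationAt F E x₀).baseSet

/-- The term `∑_{i<j} (-1)^{i+j} α([s_i, s_j], s_0, …, ŝ_i, …, ŝ_j, …, s_q)` of the exterior
derivative of a `q`-form `α` (it is an empty sum if `q = 0`). -/
def bracketTerm (A : BanachLieAlgebroid B F E) : ∀ {q : ℕ} (_ : ∀ x : M, E x [⋀^Fin q]→L[ℝ] ℝ)
    (_ : Fin (q + 1) → Cₛ^∞⟮𝓘(ℝ, B); F, E⟯) (_ : M), ℝ
  | 0, _, _, _ => 0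
  | n + 1, α, s, x => ∑ j : Fin (n + 2), ∑ i : Fin (n + 1),
      if i.castSucc < j then
        (-1 : ℝ) ^ ((i : ℕ) + (j : ℕ)) *
          α x (Fin.cons (A.bracket (s i.castSucc) (s j) x)
            (fun k : Fin n ↦ s (j.succAbove (i.succAbove k)) x))
      else 0

/-- `β = d_ρ α`: the value of the `(q+1)`-form `β` on all families of sections is
`∑_i (-1)^i ρ(s_i)(α(s_0, …, ŝ_i, …, s_q)) + ∑_{i<j} (-1)^{i+j} α([s_i, s_j], …, ŝ_i, …, ŝ_j, …)`. -/
def IsExtDeriv (A : BanachLieAlgebroid B F E) {q : ℕ} (α : ∀ x : M, E x [⋀^Fin q]→L[ℝ] ℝ)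
    (β : ∀ x : M, E x [⋀^Fin (q + 1)]→L[ℝ] ℝ) : Prop :=
  ∀ (s : Fin (q + 1) → Cₛ^∞⟮𝓘(ℝ, B); F, E⟯) (x : M),
    β x (fun k ↦ s k x) =
      ∑ i : Fin (q + 1), (-1 : ℝ) ^ (i : ℕ) *
        dirDeriv (fun y ↦ α y (fun k ↦ s (i.succAbove k) y)) (A.anchor x (s i x))
      + A.bracketTerm α s x

/-- Admissible curves in a Banach Lie algebroid, on a set `J` of times: `(π ∘ γ)' = ρ(γ)` on `J`. -/
def IsAdmissibleOn (A : BanachLieAlgebroid B F E) (γ : ℝ → TotalSpace F E) (J : Set ℝ) : Prop :=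
  ∀ t ∈ J, HasMFDerivWithinAt 𝓘(ℝ) 𝓘(ℝ, B) (fun s ↦ (γ s).proj) J t
    ((1 : ℝ →L[ℝ] ℝ).smulRight (A.anchor (γ t).proj (γ t).2))

variable (B F) in
/-- Smooth vector fields on the total space `E`, as smooth sections `S : E → TE`. -/
structure IsVectorField
    (S : TotalSpace F E → TangentBundle (𝓘(ℝ, B).prod 𝓘(ℝ, F)) (TotalSpace F E)) : Prop where
  contMDiff : ContMDiff (𝓘(ℝ, B).prod 𝓘(ℝ, F)) (𝓘(ℝ, B).prod 𝓘(ℝ, F)).tangent ∞ S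
  proj_eq : ∀ u, (S u).proj = u

/-- Semisprays: smooth `S : E → TE` with `τ_E ∘ S = id` and `Tπ ∘ S = ρ`. -/
structure IsSemispray (A : BanachLieAlgebroid B F E)
    (S : TotalSpace F E → TangentBundle (𝓘(ℝ, B).prod 𝓘(ℝ, F)) (TotalSpace F E)) : Prop
    extends IsVectorField B F S where
  tangent_eq : ∀ u,
    tangentMap (𝓘(ℝ, B).prod 𝓘(ℝ, F)) 𝓘(ℝ, B) (TotalSpace.proj : TotalSpace F E → M) (S u) = A.rho u

end Single

section Morphism

variable {B F : Type*} [NormedAddCommGroup B] [NormedSpace ℝ B]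
  [NormedAddCommGroup F] [NormedSpace ℝ F]
  {M : Type*} [TopologicalSpace M] [ChartedSpace B M] [IsManifold 𝓘(ℝ, B) ∞ M]
  {E : M → Type*} [∀ x, AddCommGroup (E x)] [∀ x, Module ℝ (E x)] [∀ x, TopologicalSpace (E x)]
  [TopologicalSpace (TotalSpace F E)] [FiberBundle F E] [VectorBundle ℝ F E]
  [ContMDiffVectorBundle ∞ F E 𝓘(ℝ, B)]
  {B' F' : Type*} [NormedAddCommGroup B'] [NormedSpace ℝ B']
  [NormedAddCommGroup F'] [NormedSpace ℝ F']
  {M' : Type*} [TopologicalSpace M'] [ChartedSpace B' M'] [IsManifold 𝓘(ℝ, B') ∞ M']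
  {E' : M' → Type*} [∀ x, AddCommGroup (E' x)] [∀ x, Module ℝ (E' x)]
  [∀ x, TopologicalSpace (E' x)]
  [TopologicalSpace (TotalSpace F' E')] [FiberBundle F' E'] [VectorBundle ℝ F' E']
  [ContMDiffVectorBundle ∞ F' E' 𝓘(ℝ, B')]

/-- A vector bundle morphism `ψ : E → E'` over `f : M → M'` is a morphism of Lie algebroids if the
pull-back of smooth forms, `(ψ^* α)_x = α_{f x}(ψ_x ·, …, ψ_x ·)`, commutes with the exterior
derivatives in all degrees. -/
structure IsMorphism (A : BanachLieAlgebroid B F E) (A' : BanachLieAlgebroid B' F' E') (f : M → M')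
    (ψ : ∀ x : M, E x →L[ℝ] E' (f x)) : Prop where
  contMDiff_base : ContMDiff 𝓘(ℝ, B) 𝓘(ℝ, B') ∞ f
  contMDiff_total : ContMDiff (𝓘(ℝ, B).prod 𝓘(ℝ, F)) (𝓘(ℝ, B').prod 𝓘(ℝ, F')) ∞
    (fun u : TotalSpace F E ↦ (⟨f u.proj, ψ u.proj u.2⟩ : TotalSpace F' E'))
  pullback_extDeriv : ∀ (q : ℕ) (α : ∀ x : M', E' x [⋀^Fin q]→L[ℝ] ℝ)
    (β : ∀ x : M', E' x [⋀^Fin (q + 1)]→L[ℝ] ℝ),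
    IsSmoothForm B' F' α → IsSmoothForm B' F' β → A'.IsExtDeriv α β →
      A.IsExtDeriv (fun x ↦ (α (f x)).compContinuousLinearMap (ψ x))
        (fun x ↦ (β (f x)).compContinuousLinearMap (ψ x))

end Morphism

end BanachLieAlgebroid

/-! ### Curves in topological vector spaces -/

/-- A curve `g` in a topological vector space is smooth on a set `J` of times if all its iterated
derivatives (limits of difference quotients, within `J`) exist on `J`. -/
def IsSmoothCurveIn {V : Type*} [AddCommGroup V] [Module ℝ V] [TopologicalSpace V]
    (g : ℝ → V) (J : Set ℝ) : Prop :=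
  ∃ G : ℕ → ℝ → V, (∀ t ∈ J, G 0 t = g t) ∧
    ∀ n, ∀ t ∈ J, Tendsto (slope (G n) t) (𝓝[J \ {t}] t) (𝓝 (G (n + 1) t))

/-! ### Projective systems of Banach manifolds and their limits -/

/-- A projective sequence of Banach manifolds `(M_i, δ_i^j)` with smooth transition maps, together
with a projective sequence of continuous linear maps between the Banach spaces `B_i` on which they
are modelled. -/
structure ManifoldSystem {B : ℕ → Type*} [∀ i, NormedAddCommGroup (B i)]
    [∀ i, NormedSpace ℝ (B i)] {H : ℕ → Type*} [∀ i, TopologicalSpace (H i)]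
    (I : ∀ i, ModelWithCorners ℝ (B i) (H i))
    (M : ℕ → Type*) [∀ i, TopologicalSpace (M i)] [∀ i, ChartedSpace (H i) (M i)] where
  map : ∀ ⦃i j : ℕ⦄, i ≤ j → M j → M i
  contMDiff_map : ∀ ⦃i j : ℕ⦄ (h : i ≤ j), ContMDiff (I j) (I i) ∞ (map h)
  map_refl : ∀ (i : ℕ) (x : M i), map le_rfl x = x
  map_map : ∀ ⦃i j k : ℕ⦄ (hij : i ≤ j) (hjk : j ≤ k) (x : M k),
    map hij (map hjk x) = map (hij.trans hjk) x
  modelMap : ∀ ⦃i j : ℕ⦄, i ≤ j → B j →L[ℝ] B i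
  modelMap_refl : ∀ (i : ℕ) (v : B i), modelMap le_rfl v = v
  modelMap_modelMap : ∀ ⦃i j k : ℕ⦄ (hij : i ≤ j) (hjk : j ≤ k) (v : B k),
    modelMap hij (modelMap hjk v) = modelMap (hij.trans hjk) v

namespace ManifoldSystem

section Limit

variable {B : ℕ → Type*} [∀ i, NormedAddCommGroup (B i)]
  [∀ i, NormedSpace ℝ (B i)] {H : ℕ → Type*} [∀ i, TopologicalSpace (H i)]
  {I : ∀ i, ModelWithCorners ℝ (B i) (H i)}
  {M : ℕ → Type*} [∀ i, TopologicalSpace (M i)] [∀ i, ChartedSpace (H i) (M i)]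

/-- The projective limit: the space of threads, with the topology induced by the product. -/
abbrev Lim (P : ManifoldSystem I M) : Type _ :=
  {x : ∀ i, M i // ∀ ⦃i j : ℕ⦄ (h : i ≤ j), P.map h (x j) = x i}

/-- The Fréchet space `lim B_i`, as a subspace of the product. -/
def modelLim (P : ManifoldSystem I M) : Submodule ℝ (∀ i, B i) where
  carrier := {v | ∀ ⦃i j : ℕ⦄ (h : i ≤ j), P.modelMap h (v j) = v i}
  add_mem' hv hw i j h := by simp [hv h, hw h]
  zero_mem' i j h := by simp
  smul_mem' a v hv i j h := by simp [hv h]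

/-- The tangent bundle of the limit, `lim TM_i`: threads for the tangent maps `Tδ_i^j`. -/
abbrev TLim (P : ManifoldSystem I M) : Type _ :=
  {w : ∀ i, TangentBundle (I i) (M i) //
    ∀ ⦃i j : ℕ⦄ (h : i ≤ j), tangentMap (I j) (I i) (P.map h) (w j) = w i}

/-- The projection `τ : lim TM_i → lim M_i`. -/
def tau (P : ManifoldSystem I M) (w : P.TLim) : P.Lim :=
  ⟨fun i ↦ (w.1 i).proj, fun _ _ h ↦ congrArg TotalSpace.proj (w.2 h)⟩

/-- A projective system of charts `φ_i : U_i → B_i`, compatible with the transition maps, such that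
`lim U_i` is open in `lim M_i`. -/
structure IsLimChart (P : ManifoldSystem I M) (φ : ∀ i, OpenPartialHomeomorph (M i) (H i)) :
    Prop where
  mem_maximalAtlas : ∀ i, φ i ∈ IsManifold.maximalAtlas (I i) ∞ (M i)
  mapsTo : ∀ ⦃i j : ℕ⦄ (h : i ≤ j), MapsTo (P.map h) (φ j).source (φ i).source
  coherent : ∀ ⦃i j : ℕ⦄ (h : i ≤ j), ∀ x ∈ (φ j).source,
    (φ i).extend (I i) (P.map h x) = P.modelMap h ((φ j).extend (I j) x)
  isOpen_source : IsOpen {x : P.Lim | ∀ i, x.1 i ∈ (φ i).source}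

/-- The system is strong if every thread lies in the domain of a projective system of charts. -/
def IsStrong (P : ManifoldSystem I M) : Prop :=
  ∀ x : P.Lim, ∃ φ : ∀ i, OpenPartialHomeomorph (M i) (H i),
    P.IsLimChart φ ∧ ∀ i, x.1 i ∈ (φ i).source

open Classical in
/-- The limit chart `φ = lim φ_i : lim U_i → lim B_i` (with value `0` outside `lim U_i`). -/
def limChart (P : ManifoldSystem I M) {φ : ∀ i, OpenPartialHomeomorph (M i) (H i)}
    (hφ : P.IsLimChart φ) (x : P.Lim) : P.modelLim :=
  if hx : ∀ i, x.1 i ∈ (φ i).source then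
    ⟨fun i ↦ (φ i).extend (I i) (x.1 i), fun i j h ↦ by
      rw [← hφ.coherent h _ (hx j), x.2 h]⟩
  else 0

/-- Smooth curves in the Fréchet manifold `lim M_i`, on a set `J` of times: locally, the curve lies
in the domain of a limit chart and is smooth in this chart. -/
def IsSmoothCurveOn (P : ManifoldSystem I M) (c : ℝ → P.Lim) (J : Set ℝ) : Prop :=
  ∀ t₀ ∈ J, ∃ (φ : ∀ i, OpenPartialHomeomorph (M i) (H i)) (hφ : P.IsLimChart φ) (O : Set ℝ),
    IsOpen O ∧ t₀ ∈ O ∧ (∀ t ∈ J ∩ O, ∀ i, (c t).1 i ∈ (φ i).source) ∧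
    IsSmoothCurveIn (fun t ↦ P.limChart hφ (c t)) (J ∩ O)

/-- The limit `(u_0, u_1, …) ↦ (S_0(u_0), S_1(u_1), …)` of vector fields `S_i` on `M_i` with
`Tδ_i^j ∘ S_j = S_i ∘ δ_i^j`. -/
def limField (P : ManifoldSystem I M) (S : ∀ i, M i → TangentBundle (I i) (M i))
    (hS : ∀ ⦃i j : ℕ⦄ (h : i ≤ j) (u : M j),
      tangentMap (I j) (I i) (P.map h) (S j u) = S i (P.map h u)) (u : P.Lim) : P.TLim :=
  ⟨fun i ↦ S i (u.1 i), fun i j h ↦ by rw [hS h, u.2 h]⟩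

theorem mfderiv_chart_coherent (P : ManifoldSystem I M)
    {φ : ∀ i, OpenPartialHomeomorph (M i) (H i)} (hφ : P.IsLimChart φ) (w : P.TLim)
    (hw : ∀ i, (w.1 i).proj ∈ (φ i).source) ⦃i j : ℕ⦄ (h : i ≤ j) :
    P.modelMap h (mfderiv (I j) 𝓘(ℝ, B j) ((φ j).extend (I j)) (w.1 j).proj (w.1 j).2) =
      (mfderiv (I i) 𝓘(ℝ, B i) ((φ i).extend (I i)) (w.1 i).proj (w.1 i).2 : B i) := by
  have hd : ∀ k, ∀ x ∈ (φ k).source,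
      MDifferentiableAt (I k) 𝓘(ℝ, B k) ((φ k).extend (I k)) x := fun k x hx ↦
    ((OpenPartialHomeomorph.contMDiffOn_extend (hφ.mem_maximalAtlas k) x hx).contMDiffAt
      ((φ k).open_source.mem_nhds hx)).mdifferentiableAt (by simp)
  rw [← w.2 h]
  have h1 : mfderiv (I j) 𝓘(ℝ, B i) ((φ i).extend (I i) ∘ P.map h) (w.1 j).proj =
      mfderiv (I j) 𝓘(ℝ, B i) (P.modelMap h ∘ (φ j).extend (I j)) (w.1 j).proj := by
    apply Filter.EventuallyEq.mfderiv_eq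
    filter_upwards [(φ j).open_source.mem_nhds (hw j)] with x hx
    exact hφ.coherent h x hx
  rw [mfderiv_comp (I' := I i) _ (hd i _ (hφ.mapsTo h (hw j)))
      ((P.contMDiff_map h).mdifferentiableAt (by simp)),
    mfderiv_comp (I' := 𝓘(ℝ, B j)) _ (P.modelMap h).mdifferentiableAt (hd j _ (hw j)),
    ContinuousLinearMap.mfderiv_eq] at h1
  exact (DFunLike.congr_fun h1 (w.1 j).2).symm

open Classical in
/-- The linear part `lim dφ_i` of the chart `Tφ : TU → lim B_i × lim B_i` of the tangent bundle that
is induced by the limit chart `φ` (with value `0` outside its domain). -/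
def limChartDeriv (P : ManifoldSystem I M) {φ : ∀ i, OpenPartialHomeomorph (M i) (H i)}
    (hφ : P.IsLimChart φ) (w : P.TLim) : P.modelLim :=
  if hw : ∀ i, (w.1 i).proj ∈ (φ i).source then
    ⟨fun i ↦ mfderiv (I i) 𝓘(ℝ, B i) ((φ i).extend (I i)) (w.1 i).proj (w.1 i).2,
      fun _ _ h ↦ P.mfderiv_chart_coherent hφ w hw h⟩
  else 0

/-- `c'(t) = w` for a curve `c` in the Fréchet manifold `lim M_i` (derivative within `J`): `w` is a
tangent vector at `c t`, the curve is continuous at `t`, and in a limit chart `φ` at `c t` the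
derivative of `φ ∘ c` at `t`, in the Fréchet space `lim B_i`, is the vector that represents `w`. -/
def HasVelocityWithinAt (P : ManifoldSystem I M) (c : ℝ → P.Lim) (J : Set ℝ) (t : ℝ)
    (w : P.TLim) : Prop :=
  P.tau w = c t ∧ ContinuousWithinAt c J t ∧
    ∃ (φ : ∀ i, OpenPartialHomeomorph (M i) (H i)) (hφ : P.IsLimChart φ),
      (∀ i, (c t).1 i ∈ (φ i).source) ∧
      Tendsto (slope (fun s ↦ P.limChart hφ (c s)) t) (𝓝[J \ {t}] t) (𝓝 (P.limChartDeriv hφ w))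

/-- Smooth curves in the tangent bundle of `lim M_i`: they are smooth in the charts `Tφ`. -/
def IsSmoothTangentCurveOn (P : ManifoldSystem I M) (w : ℝ → P.TLim) (J : Set ℝ) : Prop :=
  ∀ t₀ ∈ J, ∃ (φ : ∀ i, OpenPartialHomeomorph (M i) (H i)) (hφ : P.IsLimChart φ) (O : Set ℝ),
    IsOpen O ∧ t₀ ∈ O ∧ (∀ t ∈ J ∩ O, ∀ i, ((w t).1 i).proj ∈ (φ i).source) ∧
    IsSmoothCurveIn (fun t ↦ (P.limChart hφ (P.tau (w t)), P.limChartDeriv hφ (w t))) (J ∩ O)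

/-- Smooth vector fields on `lim M_i`: sections `S` of the tangent bundle that are smooth in the
sense of the convenient calculus, that is, map smooth curves to smooth curves. -/
structure IsVectorField (P : ManifoldSystem I M) (S : P.Lim → P.TLim) : Prop where
  smooth : ∀ c : ℝ → P.Lim, P.IsSmoothCurveOn c univ → P.IsSmoothTangentCurveOn (S ∘ c) univ
  tau_eq : ∀ u, P.tau (S u) = u

/-- Integral curves of a vector field on `lim M_i`: smooth curves with `c' = S(c)`. -/
def IsIntegralCurveOn (P : ManifoldSystem I M) (S : P.Lim → P.TLim) (c : ℝ → P.Lim)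
    (J : Set ℝ) : Prop :=
  P.IsSmoothCurveOn c J ∧ ∀ t ∈ J, P.HasVelocityWithinAt c J t (S (c t))

end Limit

end ManifoldSystem

/-! ### Strong projective systems of Banach Lie algebroids -/

/-- A strong projective system of Banach Lie algebroids `(E_i, π_i, M_i, ρ_i)`. -/
structure StrongAlgebroidSystem {B F : ℕ → Type*}
    [∀ i, NormedAddCommGroup (B i)] [∀ i, NormedSpace ℝ (B i)]
    [∀ i, NormedAddCommGroup (F i)] [∀ i, NormedSpace ℝ (F i)]
    {M : ℕ → Type*} [∀ i, TopologicalSpace (M i)] [∀ i, ChartedSpace (B i) (M i)]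
    [∀ i, IsManifold 𝓘(ℝ, B i) ∞ (M i)]
    {E : ∀ i, M i → Type*} [∀ i x, AddCommGroup (E i x)] [∀ i x, Module ℝ (E i x)]
    [∀ i x, TopologicalSpace (E i x)] [∀ i, TopologicalSpace (TotalSpace (F i) (E i))]
    [∀ i, FiberBundle (F i) (E i)] [∀ i, VectorBundle ℝ (F i) (E i)]
    [∀ i, ContMDiffVectorBundle ∞ (F i) (E i) 𝓘(ℝ, B i)]
    (A : ∀ i, BanachLieAlgebroid (B i) (F i) (E i)) where
  /-- The base manifolds `(M_i, δ_i^j)`. -/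
  base : ManifoldSystem (fun i ↦ 𝓘(ℝ, B i)) M
  isStrong_base : base.IsStrong
  /-- The linear maps between fibres that make up `f_i^j : E_j → E_i`. -/
  fiberMap : ∀ ⦃i j : ℕ⦄ (h : i ≤ j) (x : M j), E j x →L[ℝ] E i (base.map h x)
  fiberMap_refl : ∀ (i : ℕ) (u : TotalSpace (F i) (E i)),
    (⟨base.map le_rfl u.proj, fiberMap le_rfl u.proj u.2⟩ : TotalSpace (F i) (E i)) = u
  fiberMap_fiberMap : ∀ ⦃i j k : ℕ⦄ (hij : i ≤ j) (hjk : j ≤ k) (u : TotalSpace (F k) (E k)),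
    (⟨base.map hij (base.map hjk u.proj),
      fiberMap hij (base.map hjk u.proj) (fiberMap hjk u.proj u.2)⟩ : TotalSpace (F i) (E i)) =
      ⟨base.map (hij.trans hjk) u.proj, fiberMap (hij.trans hjk) u.proj u.2⟩
  /-- The maps `λ_i^j` between the typical fibres. -/
  typicalMap : ∀ ⦃i j : ℕ⦄, i ≤ j → F j →L[ℝ] F i
  typicalMap_refl : ∀ (i : ℕ) (v : F i), typicalMap le_rfl v = v
  typicalMap_typicalMap : ∀ ⦃i j k : ℕ⦄ (hij : i ≤ j) (hjk : j ≤ k) (v : F k),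
    typicalMap hij (typicalMap hjk v) = typicalMap (hij.trans hjk) v
  /-- Around every thread there is a projective system of smooth linear trivializations `τ_i` over
  open sets `U_i` with `lim U_i` open and `(δ_i^j × λ_i^j) ∘ τ_j = τ_i ∘ f_i^j`. -/
  exists_trivializations : ∀ x : base.Lim,
    ∃ e : ∀ i, Trivialization (F i) (TotalSpace.proj : TotalSpace (F i) (E i) → M i),
      (∀ i, (e i).IsLinear ℝ) ∧
      (∀ i, ContMDiffOn (𝓘(ℝ, B i).prod 𝓘(ℝ, F i)) (𝓘(ℝ, B i).prod 𝓘(ℝ, F i)) ∞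
        (e i) (e i).source) ∧
      (∀ i, ContMDiffOn (𝓘(ℝ, B i).prod 𝓘(ℝ, F i)) (𝓘(ℝ, B i).prod 𝓘(ℝ, F i)) ∞
        (e i).toOpenPartialHomeomorph.symm (e i).target) ∧
      (∀ i, x.1 i ∈ (e i).baseSet) ∧
      IsOpen {y : base.Lim | ∀ i, y.1 i ∈ (e i).baseSet} ∧
      (∀ ⦃i j : ℕ⦄ (h : i ≤ j), MapsTo (base.map h) (e j).baseSet (e i).baseSet) ∧
      (∀ ⦃i j : ℕ⦄ (h : i ≤ j) (u : TotalSpace (F j) (E j)), u.proj ∈ (e j).baseSet →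
        e i ⟨base.map h u.proj, fiberMap h u.proj u.2⟩ =
          (base.map h (e j u).1, typicalMap h (e j u).2))
  /-- `ρ_i ∘ f_i^j = Tδ_i^j ∘ ρ_j`. -/
  anchor_compat : ∀ ⦃i j : ℕ⦄ (h : i ≤ j) (x : M j) (v : E j x),
    (A i).anchor (base.map h x) (fiberMap h x v) =
      mfderiv 𝓘(ℝ, B j) 𝓘(ℝ, B i) (base.map h) x ((A j).anchor x v)
  /-- `f_i^j` is a morphism of Lie algebroids. -/
  isMorphism : ∀ ⦃i j : ℕ⦄ (h : i ≤ j), (A j).IsMorphism (A i) (base.map h) (fiberMap h)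

namespace StrongAlgebroidSystem

section

variable {B F : ℕ → Type*}
  [∀ i, NormedAddCommGroup (B i)] [∀ i, NormedSpace ℝ (B i)]
  [∀ i, NormedAddCommGroup (F i)] [∀ i, NormedSpace ℝ (F i)]
  {M : ℕ → Type*} [∀ i, TopologicalSpace (M i)] [∀ i, ChartedSpace (B i) (M i)]
  [∀ i, IsManifold 𝓘(ℝ, B i) ∞ (M i)]
  {E : ∀ i, M i → Type*} [∀ i x, AddCommGroup (E i x)] [∀ i x, Module ℝ (E i x)]
  [∀ i x, TopologicalSpace (E i x)] [∀ i, TopologicalSpace (TotalSpace (F i) (E i))]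
  [∀ i, FiberBundle (F i) (E i)] [∀ i, VectorBundle ℝ (F i) (E i)]
  [∀ i, ContMDiffVectorBundle ∞ (F i) (E i) 𝓘(ℝ, B i)]
  {A : ∀ i, BanachLieAlgebroid (B i) (F i) (E i)}

/-- The projective system `(E_i, f_i^j)` of the total spaces, modelled on `B_i × F_i`. -/
def total (P : StrongAlgebroidSystem A) :
    ManifoldSystem (fun i ↦ 𝓘(ℝ, B i).prod 𝓘(ℝ, F i)) (fun i ↦ TotalSpace (F i) (E i)) where
  map _ _ h u := ⟨P.base.map h u.proj, P.fiberMap h u.proj u.2⟩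
  contMDiff_map _ _ h := (P.isMorphism h).contMDiff_total
  map_refl := P.fiberMap_refl
  map_map := P.fiberMap_fiberMap
  modelMap _ _ h := (P.base.modelMap h).prodMap (P.typicalMap h)
  modelMap_refl i v := Prod.ext (P.base.modelMap_refl i v.1) (P.typicalMap_refl i v.2)
  modelMap_modelMap _ _ _ hij hjk v :=
    Prod.ext (P.base.modelMap_modelMap hij hjk v.1) (P.typicalMap_typicalMap hij hjk v.2)

/-- `π = lim π_i : lim E_i → lim M_i`. -/
def proj (P : StrongAlgebroidSystem A) (u : P.total.Lim) : P.base.Lim :=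
  ⟨fun i ↦ (u.1 i).proj, fun _ _ h ↦ congrArg TotalSpace.proj (u.2 h)⟩

/-- `ρ = lim ρ_i : lim E_i → lim TM_i`. -/
def rho (P : StrongAlgebroidSystem A) (u : P.total.Lim) : P.base.TLim :=
  ⟨fun i ↦ (A i).rho (u.1 i), fun i j h ↦ by
    beta_reduce
    rw [← u.2 h]
    exact congrArg (fun v ↦ (⟨P.base.map h (u.1 j).proj, v⟩ : TangentBundle 𝓘(ℝ, B i) (M i)))
      (P.anchor_compat h (u.1 j).proj (u.1 j).2).symm⟩

/-- `Tπ = lim Tπ_i : lim TE_i → lim TM_i`. -/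
def tangentProj (P : StrongAlgebroidSystem A) (w : P.total.TLim) : P.base.TLim :=
  ⟨fun i ↦ tangentMap (𝓘(ℝ, B i).prod 𝓘(ℝ, F i)) 𝓘(ℝ, B i)
      (TotalSpace.proj : TotalSpace (F i) (E i) → M i) (w.1 i), fun i j h ↦ by
    have hj : MDifferentiable (𝓘(ℝ, B j).prod 𝓘(ℝ, F j)) 𝓘(ℝ, B j)
        (TotalSpace.proj : TotalSpace (F j) (E j) → M j) :=
      (contMDiff_proj (E j) (n := ∞)).mdifferentiable (by simp)
    have hi : MDifferentiable (𝓘(ℝ, B i).prod 𝓘(ℝ, F i)) 𝓘(ℝ, B i)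
        (TotalSpace.proj : TotalSpace (F i) (E i) → M i) :=
      (contMDiff_proj (E i) (n := ∞)).mdifferentiable (by simp)
    have h1 := tangentMap_comp ((P.base.contMDiff_map h).mdifferentiable (by simp)) hj
    have h2 := tangentMap_comp hi ((P.total.contMDiff_map h).mdifferentiable (by simp))
    beta_reduce
    rw [← w.2 h]
    exact (congrFun h1 (w.1 j)).symm.trans (congrFun h2 (w.1 j))⟩

/-- Semisprays on the Fréchet Lie algebroid `E = lim E_i`: smooth vector fields `S : E → TE`
(in particular `τ_E ∘ S = id`) with `Tπ ∘ S = ρ`. -/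
structure IsSemispray (P : StrongAlgebroidSystem A) (S : P.total.Lim → P.total.TLim) : Prop
    extends P.total.IsVectorField S where
  tangent_eq : ∀ u, P.tangentProj (S u) = P.rho u

/-- Admissible curves in `E = lim E_i`, on a set `J` of times: `(π ∘ c)' = ρ(c)` on `J`. -/
def IsAdmissibleOn (P : StrongAlgebroidSystem A) (c : ℝ → P.total.Lim) (J : Set ℝ) : Prop :=
  ∀ t ∈ J, P.base.HasVelocityWithinAt (fun s ↦ P.proj (c s)) J t (P.rho (c t))

end

end StrongAlgebroidSystem

end

/-!
Limit charts read curves of `lim M_i` in `lim B_i`, a closed subspace of `∏ B_i`, where limits of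
difference quotients are taken coordinate by coordinate; since difference quotients of threads are
threads, so are their limits. Hence velocities and smoothness in `lim M_i` are velocities and
smoothness of all components, and assertions about limits of admissible curves, vector fields and
semisprays reduce to their components. If `c` is an integral curve of a vector field `S` on
`lim E_i`, then `π ∘ c` has velocity `Tπ(S(c))`; velocities being unique, `c` is admissible if and
only if `Tπ ∘ S = ρ` along `c`.
-/

/-! ### Smooth curves in topological vector spaces -/

theorem uniqueDiffOn_of_ordConnected {J : Set ℝ} (hJ : J.OrdConnected) (hn : J.Nontrivial) :
    UniqueDiffOn ℝ J :=
  uniqueDiffOn_convex hJ.convex (hJ.convex.nontrivial_iff_nonempty_interior.1 hn)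

section SmoothCurves

variable {V W : Type*} [AddCommGroup V] [Module ℝ V] [TopologicalSpace V]
  [AddCommGroup W] [Module ℝ W] [TopologicalSpace W] {J : Set ℝ}

theorem IsSmoothCurveIn.clm_comp {g : ℝ → V} (hg : IsSmoothCurveIn g J) (L : V →L[ℝ] W) :
    IsSmoothCurveIn (fun t ↦ L (g t)) J := by
  obtain ⟨G, hG₀, hG⟩ := hg
  refine ⟨fun n t ↦ L (G n t), fun t ht ↦ congrArg L (hG₀ t ht), fun n t ht ↦ ?_⟩
  exact ((L.continuous.tendsto _).comp (hG n t ht)).congr fun s ↦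
    (L.toLinearMap.slope_comp (G n) t s).symm

theorem IsSmoothCurveIn.prodMk {g : ℝ → V} {k : ℝ → W} (hg : IsSmoothCurveIn g J)
    (hk : IsSmoothCurveIn k J) : IsSmoothCurveIn (fun t ↦ (g t, k t)) J := by
  obtain ⟨G, hG₀, hG⟩ := hg
  obtain ⟨K, hK₀, hK⟩ := hk
  exact ⟨fun n t ↦ (G n t, K n t), fun t ht ↦ Prod.ext (hG₀ t ht) (hK₀ t ht),
    fun n t ht ↦ (hG n t ht).prodMk_nhds (hK n t ht)⟩

theorem isSmoothCurveIn_pi_iff {ι : Type*} {V : ι → Type*} [∀ i, AddCommGroup (V i)]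
    [∀ i, Module ℝ (V i)] [∀ i, TopologicalSpace (V i)] {g : ℝ → ∀ i, V i} :
    IsSmoothCurveIn g J ↔ ∀ i, IsSmoothCurveIn (fun t ↦ g t i) J := by
  refine ⟨fun hg i ↦ hg.clm_comp (ContinuousLinearMap.proj i), fun hg ↦ ?_⟩
  choose G hG₀ hG using hg
  exact ⟨fun n t i ↦ G i n t, fun t ht ↦ funext fun i ↦ hG₀ i t ht,
    fun n t ht ↦ tendsto_pi_nhds.2 fun i ↦ hG i n t ht⟩

theorem isSmoothCurveIn_submodule_iff {U : Submodule ℝ W} (hU : IsClosed (U : Set W))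
    (hJ : UniqueDiffOn ℝ J) {g : ℝ → U} :
    IsSmoothCurveIn g J ↔ IsSmoothCurveIn (fun t ↦ (g t : W)) J := by
  refine ⟨fun hg ↦ hg.clm_comp U.subtypeL, fun ⟨G, hG₀, hG⟩ ↦ ?_⟩
  have hGU : ∀ n, ∀ t ∈ J, G n t ∈ U := by
    intro n
    induction n with
    | zero => exact fun t ht ↦ hG₀ t ht ▸ (g t).2
    | succ n ih =>
      intro t ht
      have : (𝓝[J \ {t}] t).NeBot :=
        accPt_principal_iff_nhdsWithin.1 (uniqueDiffWithinAt_iff_accPt.1 (hJ t ht))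
      refine hU.mem_of_tendsto (hG n t ht) ?_
      filter_upwards [self_mem_nhdsWithin] with s hs
      exact U.smul_mem _ (U.sub_mem (ih s hs.1) (ih t ht))
  choose! G' hG' using fun n t ht ↦ (⟨⟨G n t, hGU n t ht⟩, rfl⟩ : ∃ v : U, (v : W) = G n t)
  refine ⟨G', fun t ht ↦ Subtype.ext ((hG' 0 t ht).trans (hG₀ t ht)), fun n t ht ↦ ?_⟩
  rw [tendsto_subtype_rng, hG' (n + 1) t ht]
  refine (hG n t ht).congr' ?_
  filter_upwards [self_mem_nhdsWithin] with s hs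
  simp only [slope_def_module, ← hG' n s hs.1, ← hG' n t ht, U.coe_smul, U.coe_sub]

theorem isSmoothCurveIn_iff_contDiffOn {V : Type*} [NormedAddCommGroup V] [NormedSpace ℝ V]
    (hJ : UniqueDiffOn ℝ J) {g : ℝ → V} : IsSmoothCurveIn g J ↔ ContDiffOn ℝ ∞ g J := by
  constructor
  · rintro ⟨G, hG₀, hG⟩
    have hasDeriv : ∀ n, ∀ t ∈ J, HasDerivWithinAt (G n) (G (n + 1) t) J t := fun n t ht ↦
      hasDerivWithinAt_iff_tendsto_slope.2 (hG n t ht)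
    have iteratedDeriv_eq : ∀ n, EqOn (iteratedDerivWithin n g J) (G n) J := by
      intro n
      induction n with
      | zero => exact fun t ht ↦ (hG₀ t ht).symm
      | succ n ih =>
        intro t ht
        rw [iteratedDerivWithin_succ, derivWithin_congr ih (ih ht),
          (hasDeriv n t ht).derivWithin (hJ t ht)]
    refine contDiffOn_of_differentiableOn_deriv fun n _ t ht ↦ ?_
    exact (hasDeriv n t ht).differentiableWithinAt.congr (iteratedDeriv_eq n)
      (iteratedDeriv_eq n ht)
  · refine fun hg ↦ ⟨fun n ↦ iteratedDerivWithin n g J, fun t _ ↦ by simp, fun n t ht ↦ ?_⟩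
    have hasDeriv : HasDerivWithinAt (iteratedDerivWithin n g J)
        (iteratedDerivWithin (n + 1) g J t) J t := by
      rw [iteratedDerivWithin_succ]
      exact (hg.differentiableOn_iteratedDerivWithin (by exact_mod_cast ENat.natCast_lt_top n) hJ
        t ht).hasDerivWithinAt
    exact hasDerivWithinAt_iff_tendsto_slope.1 hasDeriv

end SmoothCurves

/-! ### Charts of manifolds and velocities of curves -/

section Charts

variable {𝕜 : Type*} [NontriviallyNormedField 𝕜] {B : Type*} [NormedAddCommGroup B]
  [NormedSpace 𝕜 B] {H : Type*} [TopologicalSpace H] {I : ModelWithCorners 𝕜 B H}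
  {M : Type*} [TopologicalSpace M]

section BundleChart

variable {F : Type*} [NormedAddCommGroup F] [NormedSpace 𝕜 F] {E : M → Type*}
  [TopologicalSpace (TotalSpace F E)]

/-- The chart of the total space of a bundle that is induced by a trivialization `e` of the bundle
and a chart `φ` of its base; its domain lies over the intersection of their domains. -/
def bundleChart (e : Trivialization F (TotalSpace.proj : TotalSpace F E → M))
    (φ : OpenPartialHomeomorph M H) : OpenPartialHomeomorph (TotalSpace F E) (ModelProd H F) :=
  e.toOpenPartialHomeomorph.trans (φ.prod (OpenPartialHomeomorph.refl F))

variable {e : Trivialization F (TotalSpace.proj : TotalSpace F E → M)}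
  {φ : OpenPartialHomeomorph M H}

theorem mem_bundleChart_source {u : TotalSpace F E} :
    u ∈ (bundleChart e φ).source ↔ u.proj ∈ e.baseSet ∧ u.proj ∈ φ.source := by
  simp only [bundleChart, OpenPartialHomeomorph.trans_source, mem_inter_iff, e.mem_source,
    mem_preimage, OpenPartialHomeomorph.prod_source, mem_prod,
    OpenPartialHomeomorph.refl_source, mem_univ, and_true]
  exact and_congr_right fun hu ↦ by rw [← e.coe_fst' hu]; rfl

theorem bundleChart_apply {u : TotalSpace F E} (hu : u.proj ∈ e.baseSet) :
    bundleChart e φ u = (φ u.proj, (e u).2) :=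
  Prod.ext (congrArg φ (e.coe_fst' hu)) rfl

theorem bundleChart_mem_maximalAtlas [ChartedSpace H M] [∀ x, TopologicalSpace (E x)]
    [FiberBundle F E] {n : ℕ∞ω} [IsManifold I n M] [IsManifold (I.prod 𝓘(𝕜, F)) n (TotalSpace F E)]
    (he : ContMDiffOn (I.prod 𝓘(𝕜, F)) (I.prod 𝓘(𝕜, F)) n e e.source)
    (he_symm : ContMDiffOn (I.prod 𝓘(𝕜, F)) (I.prod 𝓘(𝕜, F)) n
      e.toOpenPartialHomeomorph.symm e.target)
    (hφ : φ ∈ IsManifold.maximalAtlas I n M) :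
    bundleChart e φ ∈ IsManifold.maximalAtlas (I.prod 𝓘(𝕜, F)) n (TotalSpace F E) := by
  have hprod : φ.prod (OpenPartialHomeomorph.refl F) ∈
      IsManifold.maximalAtlas (I.prod 𝓘(𝕜, F)) n (M × F) :=
    IsManifold.mem_maximalAtlas_prod hφ (StructureGroupoid.id_mem_maximalAtlas _)
  refine (bundleChart e φ).mem_maximalAtlas_of_contMDiffOn ?_ ?_
  · exact (contMDiffOn_of_mem_maximalAtlas hprod).comp (he.mono inter_subset_left)
      fun _ hu ↦ hu.2
  · exact he_symm.comp ((contMDiffOn_symm_of_mem_maximalAtlas hprod).mono inter_subset_left)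
      fun _ hu ↦ hu.2

end BundleChart

variable [ChartedSpace H M]

theorem contMDiffOn_mfderiv_extend [IsManifold I 1 M] {m n : ℕ∞ω} (hmn : m + 1 ≤ n)
    {e : OpenPartialHomeomorph M H} (he : e ∈ IsManifold.maximalAtlas I n M) :
    ContMDiffOn I.tangent 𝓘(𝕜, B) m
      (fun w : TangentBundle I M ↦ (mfderiv I 𝓘(𝕜, B) (e.extend I) w.proj w.2 : B))
      (TotalSpace.proj ⁻¹' e.source) := by
  have hext := (e.contMDiffOn_extend he).contMDiffOn_tangentMapWithin hmn
    e.open_source.uniqueMDiffOn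
  refine ((contMDiff_snd_tangentBundle_modelSpace B 𝓘(𝕜, B)).comp_contMDiffOn hext).congr
    fun w hw ↦ ?_
  change _ = mfderivWithin I 𝓘(𝕜, B) (e.extend I) e.source w.proj w.2
  rw [mfderivWithin_of_isOpen e.open_source hw]

theorem contMDiffOn_extend_comp_iff {B' : Type*} [NormedAddCommGroup B'] [NormedSpace 𝕜 B']
    {H' : Type*} [TopologicalSpace H'] {I' : ModelWithCorners 𝕜 B' H'} {N : Type*}
    [TopologicalSpace N] [ChartedSpace H' N] {n : ℕ∞ω} {e : OpenPartialHomeomorph M H}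
    (he : e ∈ IsManifold.maximalAtlas I n M) {f : N → M} {s : Set N} (hf : MapsTo f s e.source) :
    ContMDiffOn I' 𝓘(𝕜, B) n (e.extend I ∘ f) s ↔ ContMDiffOn I' I n f s := by
  refine ⟨fun h ↦ ?_, fun h ↦ (e.contMDiffOn_extend he).comp h hf⟩
  exact ((contMDiffOn_extend_symm he).comp h fun x hx ↦ ⟨_, e.map_source (hf hx), rfl⟩).congr
    fun x hx ↦ (e.extend_left_inv (hf hx)).symm

end Charts

section Velocity

variable {B : Type*} [NormedAddCommGroup B] [NormedSpace ℝ B] {H : Type*} [TopologicalSpace H]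
  {I : ModelWithCorners ℝ B H} {M : Type*} [TopologicalSpace M] [ChartedSpace H M]
  {B' : Type*} [NormedAddCommGroup B'] [NormedSpace ℝ B'] {H' : Type*} [TopologicalSpace H']
  {I' : ModelWithCorners ℝ B' H'} {M' : Type*} [TopologicalSpace M'] [ChartedSpace H' M']

variable (I) in
/-- The curve `c` in the manifold `M` has velocity `w` at time `t`, within `J`. The velocity is
an element of the tangent bundle whose base point is not `c t` by definition, so that it can be a
component of a tangent vector of a limit of manifolds. -/
def HasTangentWithinAt (c : ℝ → M) (J : Set ℝ) (t : ℝ) (w : TangentBundle I M) : Prop :=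
  ∃ v : TangentSpace I (c t), w = ⟨c t, v⟩ ∧
    HasMFDerivWithinAt 𝓘(ℝ) I c J t ((1 : ℝ →L[ℝ] ℝ).smulRight v)

variable {c : ℝ → M} {J : Set ℝ} {t : ℝ} {w w' : TangentBundle I M}

theorem hasTangentWithinAt_mk_iff {v : TangentSpace I (c t)} :
    HasTangentWithinAt I c J t ⟨c t, v⟩ ↔
      HasMFDerivWithinAt 𝓘(ℝ) I c J t ((1 : ℝ →L[ℝ] ℝ).smulRight v) := by
  refine ⟨fun ⟨v', hv', h⟩ ↦ ?_, fun h ↦ ⟨v, rfl, h⟩⟩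
  cases hv'
  exact h

namespace HasTangentWithinAt

theorem proj_eq (h : HasTangentWithinAt I c J t w) : w.proj = c t := by
  obtain ⟨v, rfl, -⟩ := h
  rfl

theorem continuousWithinAt (h : HasTangentWithinAt I c J t w) : ContinuousWithinAt c J t := by
  obtain ⟨v, -, hv⟩ := h
  exact hv.continuousWithinAt

theorem comp_tangentMap (h : HasTangentWithinAt I c J t w) {f : M → M'}
    (hf : MDifferentiableAt I I' f (c t)) :
    HasTangentWithinAt I' (f ∘ c) J t (tangentMap I I' f w) := by
  obtain ⟨v, rfl, hv⟩ := h
  refine ⟨mfderiv I I' f (c t) v, rfl, ?_⟩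
  have hcomp : (mfderiv I I' f (c t)).comp ((1 : ℝ →L[ℝ] ℝ).smulRight v) =
      (1 : ℝ →L[ℝ] ℝ).smulRight (mfderiv I I' f (c t) v) :=
    ContinuousLinearMap.ext fun s ↦ (mfderiv I I' f (c t)).map_smul s v
  exact hcomp ▸ hf.hasMFDerivAt.comp_hasMFDerivWithinAt t hv

theorem unique (hJ : UniqueDiffWithinAt ℝ J t) (h : HasTangentWithinAt I c J t w)
    (h' : HasTangentWithinAt I c J t w') : w = w' := by
  obtain ⟨v, rfl, hv⟩ := h
  obtain ⟨v', rfl, hv'⟩ := h'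
  have heq := UniqueMDiffWithinAt.eq hJ.uniqueMDiffWithinAt hv hv'
  have hv_eq : v = v' :=
    (one_smul ℝ v).symm.trans ((DFunLike.congr_fun heq (1 : ℝ)).trans (one_smul ℝ v'))
  rw [hv_eq]

theorem congr {c' : ℝ → M} (h : HasTangentWithinAt I c J t w) (ht : t ∈ J)
    (hc : EqOn c' c J) : HasTangentWithinAt I c' J t w := by
  obtain ⟨v, rfl, hv⟩ := h
  have hv' := hv.congr_mono (f₁ := c') hc (hc ht) Subset.rfl
  exact ⟨v, by rw [hc ht], hv'⟩

end HasTangentWithinAt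

variable {e : OpenPartialHomeomorph M H}

theorem hasMFDerivAt_extend (he : e.MDifferentiable I I) {x : M} (hx : x ∈ e.source) :
    HasMFDerivAt I 𝓘(ℝ, B) (e.extend I) x (mfderiv I I e x) :=
  (I.hasMFDerivAt (x := e x)).comp x (he.mdifferentiableAt hx).hasMFDerivAt

theorem hasMFDerivWithinAt_extend_symm (he : e.MDifferentiable I I) {x : M} (hx : x ∈ e.source) :
    HasMFDerivWithinAt 𝓘(ℝ, B) I (e.extend I).symm (range I) (e.extend I x)
      (mfderiv I I e.symm (e x)) := by
  have he_symm : ∀ y, y = e x → HasMFDerivAt I I e.symm y (mfderiv I I e.symm (e x)) := by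
    rintro _ rfl
    exact (he.mdifferentiableAt_symm (e.map_source hx)).hasMFDerivAt
  exact (he_symm _ (I.left_inv (e x))).comp_hasMFDerivWithinAt _
    (I.hasMFDerivWithinAt_symm (mem_range_self (e x)))

theorem HasTangentWithinAt.hasDerivWithinAt {g : ℝ → B} {w : TangentBundle 𝓘(ℝ, B) B}
    (h : HasTangentWithinAt 𝓘(ℝ, B) g J t w) : HasDerivWithinAt g (w.2 : B) J t := by
  obtain ⟨v, rfl, hv⟩ := h
  exact hasDerivWithinAt_iff_hasFDerivWithinAt.2 hv.hasFDerivWithinAt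

theorem hasTangentWithinAt_iff_hasDerivWithinAt_extend
    (he : e.MDifferentiable I I) (hx : c t ∈ e.source) :
    HasTangentWithinAt I c J t w ↔ w.proj = c t ∧ ContinuousWithinAt c J t ∧
      HasDerivWithinAt (e.extend I ∘ c)
        (mfderiv I 𝓘(ℝ, B) (e.extend I) w.proj w.2 : B) J t := by
  have hext := hasMFDerivAt_extend he hx
  refine ⟨fun h ↦ ⟨h.proj_eq, h.continuousWithinAt,
    (h.comp_tangentMap hext.mdifferentiableAt).hasDerivWithinAt⟩, fun ⟨hw, hc, hd⟩ ↦ ?_⟩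
  obtain ⟨x, v⟩ := w
  obtain rfl : x = c t := hw
  have hcurve := (hasMFDerivWithinAt_extend_symm he hx).comp t
    hd.hasFDerivWithinAt.hasMFDerivWithinAt fun s _ ↦ mem_range_self (e (c s))
  have hinv : c =ᶠ[𝓝[J] t] (e.extend I).symm ∘ e.extend I ∘ c := by
    filter_upwards [hc (e.open_source.mem_nhds hx)] with s hs using (e.extend_left_inv hs).symm
  have hderiv : mfderiv I I e.symm (e (c t)) (mfderiv I 𝓘(ℝ, B) (e.extend I) (c t) v) = v := by
    rw [hext.mfderiv]
    exact DFunLike.congr_fun (he.symm_comp_deriv hx) v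
  refine ⟨v, rfl, (hcurve.congr_of_eventuallyEq hinv (e.extend_left_inv hx).symm).congr_mfderiv ?_⟩
  exact ContinuousLinearMap.ext fun s : ℝ ↦ ((mfderiv I I e.symm (e (c t))).map_smul s _).trans
    (congrArg (fun u : B ↦ s • u) hderiv)

end Velocity

/-! ### Curves and vector fields on limits of Banach manifolds -/

namespace ManifoldSystem

variable {B : ℕ → Type*} [∀ i, NormedAddCommGroup (B i)]
  [∀ i, NormedSpace ℝ (B i)] {H : ℕ → Type*} [∀ i, TopologicalSpace (H i)]
  {I : ∀ i, ModelWithCorners ℝ (B i) (H i)}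
  {M : ℕ → Type*} [∀ i, TopologicalSpace (M i)] [∀ i, ChartedSpace (H i) (M i)]
  {P : ManifoldSystem I M} {J : Set ℝ} {t : ℝ}

section ModelSpace

variable {g : ℝ → P.modelLim}

theorem isClosed_modelLim (P : ManifoldSystem I M) : IsClosed (P.modelLim : Set (∀ i, B i)) := by
  have : (P.modelLim : Set (∀ i, B i)) =
      ⋂ (i) (j) (h : i ≤ j), {v | P.modelMap h (v j) = v i} := by
    ext v
    simp only [mem_iInter]
    rfl
  rw [this]
  exact isClosed_iInter fun i ↦ isClosed_iInter fun j ↦ isClosed_iInter fun h ↦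
    isClosed_eq ((P.modelMap h).continuous.comp (continuous_apply j)) (continuous_apply i)

theorem isSmoothCurveIn_modelLim_iff (hJ : UniqueDiffOn ℝ J) :
    IsSmoothCurveIn g J ↔ ∀ i, ContDiffOn ℝ ∞ (fun t ↦ (g t).1 i) J :=
  (isSmoothCurveIn_submodule_iff P.isClosed_modelLim hJ).trans <|
    isSmoothCurveIn_pi_iff.trans <| forall_congr' fun _ ↦ isSmoothCurveIn_iff_contDiffOn hJ

theorem tendsto_slope_modelLim_iff {v : P.modelLim} :
    Tendsto (slope g t) (𝓝[J \ {t}] t) (𝓝 v) ↔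
      ∀ i, HasDerivWithinAt (fun s ↦ (g s).1 i) (v.1 i) J t := by
  simp only [tendsto_subtype_rng, tendsto_pi_nhds, hasDerivWithinAt_iff_tendsto_slope]
  rfl

end ModelSpace

section LimChart

variable {φ : ∀ i, OpenPartialHomeomorph (M i) (H i)} {c : ℝ → P.Lim} {w : P.TLim}

theorem IsLimChart.mdifferentiable (hφ : P.IsLimChart φ) (i : ℕ) :
    (φ i).MDifferentiable (I i) (I i) :=
  ⟨(contMDiffOn_of_mem_maximalAtlas (hφ.mem_maximalAtlas i)).mdifferentiableOn (by simp),
    (contMDiffOn_symm_of_mem_maximalAtlas (hφ.mem_maximalAtlas i)).mdifferentiableOn (by simp)⟩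

theorem limChart_apply (hφ : P.IsLimChart φ) {x : P.Lim} (hx : ∀ i, x.1 i ∈ (φ i).source)
    (i : ℕ) : (P.limChart hφ x).1 i = (φ i).extend (I i) (x.1 i) := by
  rw [limChart, dif_pos hx]

theorem limChartDeriv_apply (hφ : P.IsLimChart φ) (hw : ∀ i, (w.1 i).proj ∈ (φ i).source)
    (i : ℕ) : (P.limChartDeriv hφ w).1 i =
      (mfderiv (I i) 𝓘(ℝ, B i) ((φ i).extend (I i)) (w.1 i).proj (w.1 i).2 : B i) := by
  rw [limChartDeriv, dif_pos hw]

theorem isSmoothCurveIn_limChart_iff (hφ : P.IsLimChart φ) (hJ : UniqueDiffOn ℝ J)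
    (hc : ∀ t ∈ J, ∀ i, (c t).1 i ∈ (φ i).source) :
    IsSmoothCurveIn (fun t ↦ P.limChart hφ (c t)) J ↔
      ∀ i, ContMDiffOn 𝓘(ℝ) (I i) ∞ (fun t ↦ (c t).1 i) J := by
  refine (isSmoothCurveIn_modelLim_iff hJ).trans (forall_congr' fun i ↦ ?_)
  rw [contDiffOn_congr fun t ht ↦ limChart_apply hφ (hc t ht) i, ← contMDiffOn_iff_contDiffOn]
  exact contMDiffOn_extend_comp_iff (hφ.mem_maximalAtlas i) fun t ht ↦ hc t ht i

theorem isSmoothCurveIn_limChartDeriv [∀ i, IsManifold (I i) ∞ (M i)] (hφ : P.IsLimChart φ)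
    (hJ : UniqueDiffOn ℝ J) {w : ℝ → P.TLim} (hw : ∀ t ∈ J, ∀ i, ((w t).1 i).proj ∈ (φ i).source)
    (h : ∀ i, ContMDiffOn 𝓘(ℝ) (I i).tangent ∞ (fun t ↦ (w t).1 i) J) :
    IsSmoothCurveIn (fun t ↦ P.limChartDeriv hφ (w t)) J := by
  refine (isSmoothCurveIn_modelLim_iff hJ).2 fun i ↦ ?_
  have : IsManifold (I i) 1 (M i) := .of_le (n := ∞) (by simp)
  have hderiv := (contMDiffOn_mfderiv_extend (m := ∞) (by simp) (hφ.mem_maximalAtlas i)).comp (h i)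
    fun t ht ↦ hw t ht i
  exact hderiv.contDiffOn.congr fun t ht ↦ limChartDeriv_apply hφ (hw t ht) i

theorem tendsto_slope_limChart_iff (hφ : P.IsLimChart φ) (hx : ∀ i, (c t).1 i ∈ (φ i).source)
    (hc : ContinuousWithinAt c J t) (hw : P.tau w = c t) :
    Tendsto (slope (fun s ↦ P.limChart hφ (c s)) t) (𝓝[J \ {t}] t)
      (𝓝 (P.limChartDeriv hφ w)) ↔
      ∀ i, HasTangentWithinAt (I i) (fun s ↦ (c s).1 i) J t (w.1 i) := by
  have hwi : ∀ i, (w.1 i).proj = (c t).1 i := fun i ↦ congrFun (congrArg Subtype.val hw) i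
  have hci : ∀ i, ContinuousWithinAt (fun s ↦ (c s).1 i) J t :=
    tendsto_pi_nhds.1 (tendsto_subtype_rng.1 hc)
  have hchart : ∀ i, (fun s ↦ (P.limChart hφ (c s)).1 i) =ᶠ[𝓝[J] t]
      (φ i).extend (I i) ∘ fun s ↦ (c s).1 i := fun i ↦ by
    filter_upwards [hc.eventually (hφ.isOpen_source.mem_nhds hx)] with s hs
      using limChart_apply hφ hs i
  refine tendsto_slope_modelLim_iff.trans (forall_congr' fun i ↦ ?_)
  rw [hasTangentWithinAt_iff_hasDerivWithinAt_extend (hφ.mdifferentiable i) (hx i),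
    (hchart i).hasDerivWithinAt_iff (limChart_apply hφ hx i),
    limChartDeriv_apply hφ fun i ↦ (hwi i).symm ▸ hx i]
  exact ⟨fun h ↦ ⟨hwi i, hci i, h⟩, fun h ↦ h.2.2⟩

end LimChart

section Strong

variable {c : ℝ → P.Lim}

theorem IsStrong.hasVelocityWithinAt_iff (hP : P.IsStrong) {w : P.TLim} :
    P.HasVelocityWithinAt c J t w ↔
      ∀ i, HasTangentWithinAt (I i) (fun s ↦ (c s).1 i) J t (w.1 i) := by
  constructor
  · rintro ⟨hw, hc, φ, hφ, hx, hlim⟩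
    exact (tendsto_slope_limChart_iff hφ hx hc hw).1 hlim
  · intro h
    obtain ⟨φ, hφ, hx⟩ := hP (c t)
    have hw : P.tau w = c t := Subtype.ext (funext fun i ↦ (h i).proj_eq)
    have hc : ContinuousWithinAt c J t :=
      tendsto_subtype_rng.2 (tendsto_pi_nhds.2 fun i ↦ (h i).continuousWithinAt)
    exact ⟨hw, hc, φ, hφ, hx, (tendsto_slope_limChart_iff hφ hx hc hw).2 h⟩

theorem IsStrong.hasVelocityWithinAt_unique (hP : P.IsStrong) (hJ : UniqueDiffWithinAt ℝ J t)
    {w w' : P.TLim} (h : P.HasVelocityWithinAt c J t w) (h' : P.HasVelocityWithinAt c J t w') :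
    w = w' :=
  Subtype.ext <| funext fun i ↦
    (hP.hasVelocityWithinAt_iff.1 h i).unique hJ (hP.hasVelocityWithinAt_iff.1 h' i)

theorem IsStrong.exists_isLimChart_source (hP : P.IsStrong) (hc : ContinuousOn c J) (ht : t ∈ J) :
    ∃ (φ : ∀ i, OpenPartialHomeomorph (M i) (H i)) (_ : P.IsLimChart φ) (O : Set ℝ),
      IsOpen O ∧ t ∈ O ∧ ∀ s ∈ J ∩ O, ∀ i, (c s).1 i ∈ (φ i).source := by
  obtain ⟨φ, hφ, hx⟩ := hP (c t)
  obtain ⟨O, hO, htO, hOJ⟩ := mem_nhdsWithin.1 (hc t ht (hφ.isOpen_source.mem_nhds hx))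
  exact ⟨φ, hφ, O, hO, htO, fun s hs ↦ hOJ hs.symm⟩

theorem IsStrong.isSmoothCurveOn_iff (hP : P.IsStrong) (hJ : UniqueDiffOn ℝ J) :
    P.IsSmoothCurveOn c J ↔ ∀ i, ContMDiffOn 𝓘(ℝ) (I i) ∞ (fun t ↦ (c t).1 i) J := by
  refine ⟨fun hc i t ht ↦ ?_, fun h t ht ↦ ?_⟩
  · obtain ⟨φ, hφ, O, hO, htO, hsource, hsmooth⟩ := hc t ht
    have := (isSmoothCurveIn_limChart_iff hφ (hJ.inter hO) hsource).1 hsmooth i t ⟨ht, htO⟩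
    exact this.mono_of_mem_nhdsWithin (inter_mem_nhdsWithin J (hO.mem_nhds htO))
  · have hc : ContinuousOn c J := fun s hs ↦
      tendsto_subtype_rng.2 (tendsto_pi_nhds.2 fun i ↦ (h i).continuousOn s hs)
    obtain ⟨φ, hφ, O, hO, htO, hsource⟩ := hP.exists_isLimChart_source hc ht
    exact ⟨φ, hφ, O, hO, htO, hsource, (isSmoothCurveIn_limChart_iff hφ (hJ.inter hO) hsource).2
      fun i ↦ (h i).mono inter_subset_left⟩

variable [∀ i, IsManifold (I i) ∞ (M i)]

theorem IsStrong.isSmoothTangentCurveOn (hP : P.IsStrong) (hJ : UniqueDiffOn ℝ J)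
    {w : ℝ → P.TLim} (h : ∀ i, ContMDiffOn 𝓘(ℝ) (I i).tangent ∞ (fun t ↦ (w t).1 i) J) :
    P.IsSmoothTangentCurveOn w J := by
  intro t ht
  have hτ : ∀ i, ContMDiffOn 𝓘(ℝ) (I i) ∞ (fun t ↦ (P.tau (w t)).1 i) J := fun i ↦
    (contMDiff_proj (TangentSpace (I i))).comp_contMDiffOn (h i)
  have hc : ContinuousOn (fun t ↦ P.tau (w t)) J := fun s hs ↦
    tendsto_subtype_rng.2 (tendsto_pi_nhds.2 fun i ↦ (hτ i).continuousOn s hs)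
  obtain ⟨φ, hφ, O, hO, htO, hsource⟩ := hP.exists_isLimChart_source hc ht
  have hJO : UniqueDiffOn ℝ (J ∩ O) := hJ.inter hO
  exact ⟨φ, hφ, O, hO, htO, hsource,
    ((isSmoothCurveIn_limChart_iff hφ hJO hsource).2 fun i ↦ (hτ i).mono inter_subset_left).prodMk
      (isSmoothCurveIn_limChartDeriv hφ hJO hsource fun i ↦ (h i).mono inter_subset_left)⟩

theorem IsStrong.isVectorField_limField (hP : P.IsStrong)
    {S : ∀ i, M i → TangentBundle (I i) (M i)}
    (hS : ∀ ⦃i j : ℕ⦄ (h : i ≤ j) (u : M j),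
      tangentMap (I j) (I i) (P.map h) (S j u) = S i (P.map h u))
    (hsmooth : ∀ i, ContMDiff (I i) (I i).tangent ∞ (S i)) (hproj : ∀ i u, (S i u).proj = u) :
    P.IsVectorField (P.limField S hS) where
  smooth _ hc := hP.isSmoothTangentCurveOn uniqueDiffOn_univ fun i ↦
    (hsmooth i).comp_contMDiffOn ((hP.isSmoothCurveOn_iff uniqueDiffOn_univ).1 hc i)
  tau_eq u := Subtype.ext (funext fun i ↦ hproj i (u.1 i))

end Strong

theorem exists_lim_apply_eqOn {α : Type*} {s : Set α} (hs : s.Nonempty) {γ : ∀ i, α → M i}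
    (hγ : ∀ ⦃i j : ℕ⦄ (h : i ≤ j), ∀ a ∈ s, P.map h (γ j a) = γ i a) :
    ∃ c : α → P.Lim, ∀ a ∈ s, ∀ i, (c a).1 i = γ i a := by
  obtain ⟨a₀, ha₀⟩ := hs
  have : Nonempty P.Lim := ⟨⟨fun i ↦ γ i a₀, fun _ _ h ↦ hγ h a₀ ha₀⟩⟩
  have hthread : ∀ a, ∃ x : P.Lim, a ∈ s → ∀ i, x.1 i = γ i a := fun a ↦ by
    by_cases ha : a ∈ s
    · exact ⟨⟨fun i ↦ γ i a, fun _ _ h ↦ hγ h a ha⟩, fun _ _ ↦ rfl⟩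
    · exact ⟨Classical.arbitrary _, fun h ↦ absurd h ha⟩
  choose c hc using hthread
  exact ⟨c, hc⟩

end ManifoldSystem

/-! ### Limits of strong projective systems of Banach Lie algebroids -/

namespace BanachLieAlgebroid

variable {B F : Type*} [NormedAddCommGroup B] [NormedSpace ℝ B]
  [NormedAddCommGroup F] [NormedSpace ℝ F]
  {M : Type*} [TopologicalSpace M] [ChartedSpace B M] [IsManifold 𝓘(ℝ, B) ∞ M]
  {E : M → Type*} [∀ x, AddCommGroup (E x)] [∀ x, Module ℝ (E x)] [∀ x, TopologicalSpace (E x)]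
  [TopologicalSpace (TotalSpace F E)] [FiberBundle F E] [VectorBundle ℝ F E]
  [ContMDiffVectorBundle ∞ F E 𝓘(ℝ, B)]
  {A : BanachLieAlgebroid B F E} {γ γ' : ℝ → TotalSpace F E} {J : Set ℝ}

theorem isAdmissibleOn_iff_hasTangentWithinAt :
    A.IsAdmissibleOn γ J ↔
      ∀ t ∈ J, HasTangentWithinAt 𝓘(ℝ, B) (fun s ↦ (γ s).proj) J t (A.rho (γ t)) :=
  forall₂_congr fun _ _ ↦ hasTangentWithinAt_mk_iff.symm

theorem IsAdmissibleOn.congr (h : A.IsAdmissibleOn γ J) (heq : EqOn γ' γ J) :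
    A.IsAdmissibleOn γ' J :=
  isAdmissibleOn_iff_hasTangentWithinAt.2 fun t ht ↦ by
    rw [heq ht]
    exact (isAdmissibleOn_iff_hasTangentWithinAt.1 h t ht).congr ht
      fun s hs ↦ congrArg TotalSpace.proj (heq hs)

end BanachLieAlgebroid

namespace StrongAlgebroidSystem

variable {B F : ℕ → Type*}
  [∀ i, NormedAddCommGroup (B i)] [∀ i, NormedSpace ℝ (B i)]
  [∀ i, NormedAddCommGroup (F i)] [∀ i, NormedSpace ℝ (F i)]
  {M : ℕ → Type*} [∀ i, TopologicalSpace (M i)] [∀ i, ChartedSpace (B i) (M i)]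
  [∀ i, IsManifold 𝓘(ℝ, B i) ∞ (M i)]
  {E : ∀ i, M i → Type*} [∀ i x, AddCommGroup (E i x)] [∀ i x, Module ℝ (E i x)]
  [∀ i x, TopologicalSpace (E i x)] [∀ i, TopologicalSpace (TotalSpace (F i) (E i))]
  [∀ i, FiberBundle (F i) (E i)] [∀ i, VectorBundle ℝ (F i) (E i)]
  [∀ i, ContMDiffVectorBundle ∞ (F i) (E i) 𝓘(ℝ, B i)]
  {A : ∀ i, BanachLieAlgebroid (B i) (F i) (E i)} {P : StrongAlgebroidSystem A}

theorem continuous_proj (P : StrongAlgebroidSystem A) : Continuous P.proj :=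
  Continuous.subtype_mk (continuous_pi fun i ↦
    (FiberBundle.continuous_proj (F i) (E i)).comp
      ((continuous_apply i).comp continuous_subtype_val)) _

theorem isStrong_total (P : StrongAlgebroidSystem A) : P.total.IsStrong := by
  intro u
  obtain ⟨φ, hφ, hxφ⟩ := P.isStrong_base (P.proj u)
  obtain ⟨e, -, he, he_symm, hxe, hopen, hmaps, hcoh⟩ := P.exists_trivializations (P.proj u)
  refine ⟨fun i ↦ bundleChart (e i) (φ i), ⟨fun i ↦ ?_, fun i j h v hv ↦ ?_,
    fun i j h v hv ↦ ?_, ?_⟩, fun i ↦ mem_bundleChart_source.2 ⟨hxe i, hxφ i⟩⟩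
  · exact bundleChart_mem_maximalAtlas (he i) (he_symm i) (hφ.mem_maximalAtlas i)
  · obtain ⟨hve, hvφ⟩ := mem_bundleChart_source.1 hv
    exact mem_bundleChart_source.2 ⟨hmaps h hve, hφ.mapsTo h hvφ⟩
  · obtain ⟨hve, hvφ⟩ := mem_bundleChart_source.1 hv
    have hfibre : (e i (P.total.map h v)).2 = P.typicalMap h (e j v).2 :=
      congrArg Prod.snd (hcoh h v hve)
    change bundleChart (e i) (φ i) (P.total.map h v) =
      P.total.modelMap h (bundleChart (e j) (φ j) v)
    rw [bundleChart_apply (hmaps h hve), bundleChart_apply hve]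
    exact Prod.ext (hφ.coherent h v.proj hvφ) hfibre
  · have hsource : {v : P.total.Lim | ∀ i, v.1 i ∈ (bundleChart (e i) (φ i)).source} =
        P.proj ⁻¹' ({x | ∀ i, x.1 i ∈ (e i).baseSet} ∩ {x | ∀ i, x.1 i ∈ (φ i).source}) := by
      ext v
      exact (forall_congr' fun _ ↦ mem_bundleChart_source).trans forall_and
    rw [hsource]
    exact (hopen.inter hφ.isOpen_source).preimage P.continuous_proj

variable {c : ℝ → P.total.Lim} {J : Set ℝ} {S : P.total.Lim → P.total.TLim}

theorem isAdmissibleOn_iff :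
    P.IsAdmissibleOn c J ↔ ∀ i, (A i).IsAdmissibleOn (fun t ↦ (c t).1 i) J := by
  simp only [BanachLieAlgebroid.isAdmissibleOn_iff_hasTangentWithinAt]
  exact (forall₂_congr fun _ _ ↦ P.isStrong_base.hasVelocityWithinAt_iff).trans
    ⟨fun h i t ht ↦ h t ht i, fun h t ht i ↦ h i t ht⟩

theorem hasVelocityWithinAt_proj {t : ℝ} {w : P.total.TLim}
    (h : P.total.HasVelocityWithinAt c J t w) :
    P.base.HasVelocityWithinAt (fun s ↦ P.proj (c s)) J t (P.tangentProj w) :=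
  P.isStrong_base.hasVelocityWithinAt_iff.2 fun i ↦
    (P.isStrong_total.hasVelocityWithinAt_iff.1 h i).comp_tangentMap
      ((contMDiff_proj (E i) (n := ∞)).mdifferentiable (by simp) _)

theorem IsSemispray.isAdmissibleOn (hS : P.IsSemispray S) (hc : P.total.IsIntegralCurveOn S c J) :
    P.IsAdmissibleOn c J := fun t ht ↦
  hS.tangent_eq (c t) ▸ hasVelocityWithinAt_proj (hc.2 t ht)

theorem isAdmissibleOn_iff_tangentProj_eq_rho (hJ : UniqueDiffOn ℝ J)
    (hc : P.total.IsIntegralCurveOn S c J) :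
    P.IsAdmissibleOn c J ↔ ∀ t ∈ J, P.tangentProj (S (c t)) = P.rho (c t) := by
  refine forall₂_congr fun t ht ↦ ?_
  have hvelocity := hasVelocityWithinAt_proj (hc.2 t ht)
  exact ⟨P.isStrong_base.hasVelocityWithinAt_unique (hJ t ht) hvelocity, fun h ↦ h ▸ hvelocity⟩

theorem isSemispray_iff_forall_isAdmissibleOn (hS : P.total.IsVectorField S) {𝒥 : Set (Set ℝ)}
    (h𝒥 : ∀ J ∈ 𝒥, UniqueDiffOn ℝ J)
    (hreach : ∀ u, ∃ J ∈ 𝒥, ∃ c, P.total.IsIntegralCurveOn S c J ∧ ∃ t ∈ J, c t = u) :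
    P.IsSemispray S ↔ ∀ J ∈ 𝒥, ∀ c, P.total.IsIntegralCurveOn S c J → P.IsAdmissibleOn c J := by
  refine ⟨fun h J _ c hc ↦ h.isAdmissibleOn hc, fun h ↦ ⟨hS, fun u ↦ ?_⟩⟩
  obtain ⟨J, hJ, c, hc, t, ht, rfl⟩ := hreach u
  exact (isAdmissibleOn_iff_tangentProj_eq_rho (h𝒥 J hJ) hc).1 (h J hJ c hc) t ht

theorem isSemispray_limField
    {S : ∀ i, TotalSpace (F i) (E i) →
      TangentBundle (𝓘(ℝ, B i).prod 𝓘(ℝ, F i)) (TotalSpace (F i) (E i))}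
    (hS : ∀ ⦃i j : ℕ⦄ (h : i ≤ j) (u : TotalSpace (F j) (E j)),
      tangentMap (𝓘(ℝ, B j).prod 𝓘(ℝ, F j)) (𝓘(ℝ, B i).prod 𝓘(ℝ, F i)) (P.total.map h) (S j u) =
        S i (P.total.map h u))
    (hs : ∀ i, (A i).IsSemispray (S i)) : P.IsSemispray (P.total.limField S hS) where
  toIsVectorField := P.isStrong_total.isVectorField_limField hS (fun i ↦ (hs i).contMDiff)
    fun i ↦ (hs i).proj_eq
  tangent_eq u := Subtype.ext (funext fun i ↦ (hs i).tangent_eq (u.1 i))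

end StrongAlgebroidSystem

open StrongAlgebroidSystem in
/-- `UniqueDiffOn ℝ J` says that every point of `J` is an accumulation point of `J`, which is what
makes velocities within `J` unique. -/
theorem mainTheorem2_general {B F : ℕ → Type*}
    [∀ i, NormedAddCommGroup (B i)] [∀ i, NormedSpace ℝ (B i)]
    [∀ i, NormedAddCommGroup (F i)] [∀ i, NormedSpace ℝ (F i)]
    {M : ℕ → Type*} [∀ i, TopologicalSpace (M i)] [∀ i, ChartedSpace (B i) (M i)]
    [∀ i, IsManifold 𝓘(ℝ, B i) ∞ (M i)]
    {E : ∀ i, M i → Type*} [∀ i x, AddCommGroup (E i x)] [∀ i x, Module ℝ (E i x)]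
    [∀ i x, TopologicalSpace (E i x)] [∀ i, TopologicalSpace (TotalSpace (F i) (E i))]
    [∀ i, FiberBundle (F i) (E i)] [∀ i, VectorBundle ℝ (F i) (E i)]
    [∀ i, ContMDiffVectorBundle ∞ (F i) (E i) 𝓘(ℝ, B i)]
    (A : ∀ i, BanachLieAlgebroid (B i) (F i) (E i)) (P : StrongAlgebroidSystem A) :
    (∀ J : Set ℝ, J.Nonempty → UniqueDiffOn ℝ J →
      ∀ γ : ∀ i, ℝ → TotalSpace (F i) (E i),
        (∀ ⦃i j : ℕ⦄ (h : i ≤ j), ∀ t ∈ J, P.total.map h (γ j t) = γ i t) →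
        (∀ i, (A i).IsAdmissibleOn (γ i) J) →
        ∃ c : ℝ → P.total.Lim, (∀ t ∈ J, ∀ i, (c t).1 i = γ i t) ∧ P.IsAdmissibleOn c J ∧
          ((∀ i, ContMDiffOn 𝓘(ℝ) (𝓘(ℝ, B i).prod 𝓘(ℝ, F i)) ∞ (γ i) J) →
            P.total.IsSmoothCurveOn c J)) ∧
    (∀ (S : ∀ i, TotalSpace (F i) (E i) →
          TangentBundle (𝓘(ℝ, B i).prod 𝓘(ℝ, F i)) (TotalSpace (F i) (E i)))
        (hS : ∀ ⦃i j : ℕ⦄ (h : i ≤ j) (u : TotalSpace (F j) (E j)),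
          tangentMap (𝓘(ℝ, B j).prod 𝓘(ℝ, F j)) (𝓘(ℝ, B i).prod 𝓘(ℝ, F i)) (P.total.map h) (S j u) =
            S i (P.total.map h u)),
        (∀ i, BanachLieAlgebroid.IsVectorField (B i) (F i) (S i)) →
        P.total.IsVectorField (P.total.limField S hS) ∧
        ((∀ i, (A i).IsSemispray (S i)) → P.IsSemispray (P.total.limField S hS)) ∧
        ∀ 𝒥 : Set (Set ℝ), (∀ J ∈ 𝒥, UniqueDiffOn ℝ J) →
          (P.IsSemispray (P.total.limField S hS) →
            ∀ J ∈ 𝒥, ∀ c, P.total.IsIntegralCurveOn (P.total.limField S hS) c J →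
              P.IsAdmissibleOn c J) ∧
          ((∀ J ∈ 𝒥, ∀ c, P.total.IsIntegralCurveOn (P.total.limField S hS) c J →
              P.IsAdmissibleOn c J) →
            ∀ J ∈ 𝒥, ∀ c, P.total.IsIntegralCurveOn (P.total.limField S hS) c J → ∀ t ∈ J,
              P.tangentProj (P.total.limField S hS (c t)) = P.rho (c t)) ∧
          ((∀ i, (A i).IsSemispray (S i)) ∨
              (∀ u, ∃ J ∈ 𝒥, ∃ c, P.total.IsIntegralCurveOn (P.total.limField S hS) c J ∧
                ∃ t ∈ J, c t = u) →
            (P.IsSemispray (P.total.limField S hS) ↔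
              ∀ J ∈ 𝒥, ∀ c, P.total.IsIntegralCurveOn (P.total.limField S hS) c J →
                P.IsAdmissibleOn c J))) := by
  refine ⟨fun J hne hJ γ hγ hadm ↦ ?_, fun S hS hv ↦ ?_⟩
  · obtain ⟨c, hc⟩ := ManifoldSystem.exists_lim_apply_eqOn hne hγ
    exact ⟨c, hc, isAdmissibleOn_iff.2 fun i ↦ (hadm i).congr fun t ht ↦ hc t ht i,
      fun hsmooth ↦ (P.isStrong_total.isSmoothCurveOn_iff hJ).2 fun i ↦
        (hsmooth i).congr fun t ht ↦ hc t ht i⟩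
  · have hfield := P.isStrong_total.isVectorField_limField hS (fun i ↦ (hv i).contMDiff)
      fun i ↦ (hv i).proj_eq
    refine ⟨hfield, isSemispray_limField hS, fun 𝒥 h𝒥 ↦ ⟨fun hs J _ c hc ↦ hs.isAdmissibleOn hc,
      fun hadm J hJ c hc ↦
        (isAdmissibleOn_iff_tangentProj_eq_rho (h𝒥 J hJ) hc).1 (hadm J hJ c hc), ?_⟩⟩
    rintro (hs | hreach)
    · have hlim := isSemispray_limField hS hs
      exact iff_of_true hlim fun J _ c hc ↦ hlim.isAdmissibleOn hc
    · exact isSemispray_iff_forall_isAdmissibleOn hfield h𝒥 hreach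

theorem mainTheorem2 {B F : ℕ → Type*}
    [∀ i, NormedAddCommGroup (B i)] [∀ i, NormedSpace ℝ (B i)] [∀ i, CompleteSpace (B i)]
    [∀ i, NormedAddCommGroup (F i)] [∀ i, NormedSpace ℝ (F i)] [∀ i, CompleteSpace (F i)]
    {M : ℕ → Type*} [∀ i, TopologicalSpace (M i)] [∀ i, ChartedSpace (B i) (M i)]
    [∀ i, IsManifold 𝓘(ℝ, B i) ∞ (M i)]
    {E : ∀ i, M i → Type*} [∀ i x, AddCommGroup (E i x)] [∀ i x, Module ℝ (E i x)]
    [∀ i x, TopologicalSpace (E i x)] [∀ i, TopologicalSpace (TotalSpace (F i) (E i))]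
    [∀ i, FiberBundle (F i) (E i)] [∀ i, VectorBundle ℝ (F i) (E i)]
    [∀ i, ContMDiffVectorBundle ∞ (F i) (E i) 𝓘(ℝ, B i)]
    (A : ∀ i, BanachLieAlgebroid (B i) (F i) (E i)) (P : StrongAlgebroidSystem A) :
    -- limits of compatible admissible curves, on an interval `J`, are admissible
    (∀ J : Set ℝ, J.OrdConnected → J.Nontrivial →
      ∀ γ : ∀ i, ℝ → TotalSpace (F i) (E i),
        (∀ ⦃i j : ℕ⦄ (h : i ≤ j), ∀ t ∈ J, P.total.map h (γ j t) = γ i t) →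
        (∀ i, (A i).IsAdmissibleOn (γ i) J) →
        ∃ c : ℝ → P.total.Lim, (∀ t ∈ J, ∀ i, (c t).1 i = γ i t) ∧ P.IsAdmissibleOn c J ∧
          ((∀ i, ContMDiffOn 𝓘(ℝ) (𝓘(ℝ, B i).prod 𝓘(ℝ, F i)) ∞ (γ i) J) →
            P.total.IsSmoothCurveOn c J)) ∧
    -- compatible vector fields `S_i` on `E_i` and their limit `S`
    (∀ (S : ∀ i, TotalSpace (F i) (E i) →
          TangentBundle (𝓘(ℝ, B i).prod 𝓘(ℝ, F i)) (TotalSpace (F i) (E i)))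
        (hS : ∀ ⦃i j : ℕ⦄ (h : i ≤ j) (u : TotalSpace (F j) (E j)),
          tangentMap (𝓘(ℝ, B j).prod 𝓘(ℝ, F j)) (𝓘(ℝ, B i).prod 𝓘(ℝ, F i)) (P.total.map h) (S j u) =
            S i (P.total.map h u)),
        (∀ i, BanachLieAlgebroid.IsVectorField (B i) (F i) (S i)) →
        P.total.IsVectorField (P.total.limField S hS) ∧
        -- a limit of semisprays is a semispray
        ((∀ i, (A i).IsSemispray (S i)) → P.IsSemispray (P.total.limField S hS)) ∧
        -- integral curves are taken on the intervals of an arbitrary family `𝒥` (all nondegenerate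
        -- intervals, or `[0, 1]` only)
        ∀ 𝒥 : Set (Set ℝ), (∀ J ∈ 𝒥, J.OrdConnected ∧ J.Nontrivial) →
          -- if the limit field is a semispray, its integral curves are admissible
          (P.IsSemispray (P.total.limField S hS) →
            ∀ J ∈ 𝒥, ∀ c, P.total.IsIntegralCurveOn (P.total.limField S hS) c J →
              P.IsAdmissibleOn c J) ∧
          -- if its integral curves are admissible, `Tπ ∘ S = ρ` at every point they reach
          ((∀ J ∈ 𝒥, ∀ c, P.total.IsIntegralCurveOn (P.total.limField S hS) c J →
              P.IsAdmissibleOn c J) →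
            ∀ J ∈ 𝒥, ∀ c, P.total.IsIntegralCurveOn (P.total.limField S hS) c J → ∀ t ∈ J,
              P.tangentProj (P.total.limField S hS (c t)) = P.rho (c t)) ∧
          -- the equivalence, for limits of semisprays and, more generally, for limits of vector
          -- fields that have an integral curve through every point of `E`
          ((∀ i, (A i).IsSemispray (S i)) ∨
              (∀ u, ∃ J ∈ 𝒥, ∃ c, P.total.IsIntegralCurveOn (P.total.limField S hS) c J ∧
                ∃ t ∈ J, c t = u) →
            (P.IsSemispray (P.total.limField S hS) ↔
              ∀ J ∈ 𝒥, ∀ c, P.total.IsIntegralCurveOn (P.total.limField S hS) c J →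
                P.IsAdmissibleOn c J))) := by
  have h := mainTheorem2_general A P
  exact ⟨fun J hJ hn ↦ h.1 J hn.nonempty (uniqueDiffOn_of_ordConnected hJ hn), fun S hS hv ↦
    (h.2 S hS hv).imp_right (And.imp_right fun H 𝒥 h𝒥 ↦
      H 𝒥 fun J hJ ↦ uniqueDiffOn_of_ordConnected (h𝒥 J hJ).1 (h𝒥 J hJ).2)⟩
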